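/- All Banach spaces are real and operators are bounded linear maps. For a Banach lattice $G$, the dual $G^{*}$ carries its dual norm and the order $f\le g \iff f(x)\le g(x)$ for all $x\ge 0$, which makes it a Banach lattice. A sequence $(f_n)$ in $G^{*}$ is disjoint if $|f_n|\wedge|f_m|=0$ for $n\ne m$, and weak* null if $f_n(x)\to 0$ for every $x\in G$. A norm bounded set $A\subseteq G$ is almost limited if every disjoint weak* null sequence $(f_n)\subset G^{*}$ converges to $0$ uniformly on $A$. An operator $T:X\to G$ from a Banach space $X$ is almost limited if $T(B_X)$ is an almost limited set, where $B_X$ is the closed unit ball, and weak almost limited if $T(W)$ is an almost limited set for every relatively weakly compact set $W\subseteq X$. The Banach lattice $G$ has property (d) if $(|f_n|)$ is weak* null for every disjoint weak* null sequence $(f_n)\subset G^{*}$; it has the positive dual Schur property if $\|f_n\|\to 0$ for every weak* null sequence $(f_n)$ of positive elements of $G^{*}$. The norm of $G$ is order continuous if $\|x_\alpha\|\to 0$ for every decreasing net $(x_\alpha)$ in $G$ with infimum $0$. An operator between Banach lattices is positive if it maps positive elements to positive elements, and order bounded if it maps every order interval into an order interval. **Theorem.** Let $E$ and $F$ be Banach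 lattices such that $F$ has property (d). Then the following statements are equivalent: 1. Every order bounded weak almost limited operator $T:E\to F$ is almost limited. 2. Every positive weak almost limited operator $T:E\to F$ is almost limited. 3. $F$ has the positive dual Schur property or the norm of $E^{*}$ is order continuous. -/

import Mathlib

open Filter Topology

namespace BanachLattice

universe u v

/-! ### The dual of a Banach lattice as a vector lattice

The order on the dual is pointwise on the positive cone; the lattice operations are obtained from
the Riesz-Kantorovich formula for the positive part. -/

section Dual

set_option linter.unusedSectionVars false

variable {E : Type u} [NormedAddCommGroup E] [Lattice E] [HasSolidNorm E] [IsOrderedAddMonoid E]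

theorem nonneg_sub_inf (z x : E) : 0 ≤ z - z ⊓ x := sub_nonneg.2 inf_le_left

theorem riesz_decomp {x y z : E} (hy : 0 ≤ y) (hzxy : z ≤ x + y) : z - z ⊓ x ≤ y := by
  rw [sub_le_iff_le_add, add_comm, inf_add]
  exact le_inf (le_add_of_nonneg_right hy) hzxy

variable [NormedSpace ℝ E]

/-- The supremum of `f` over the order interval `[0, x]`. -/
noncomputable def supIcc (f : StrongDual ℝ E) (x : E) : ℝ := sSup (f '' Set.Icc 0 x)

theorem apply_le_of_mem (f : StrongDual ℝ E) {x y : E} (hy : y ∈ Set.Icc 0 x) :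
    f y ≤ ‖f‖ * ‖x‖ := by
  have h1 : ‖y‖ ≤ ‖x‖ := norm_le_norm_of_abs_le_abs (by
    rw [abs_of_nonneg hy.1, abs_of_nonneg (hy.1.trans hy.2)]; exact hy.2)
  calc f y ≤ ‖f y‖ := Real.le_norm_self _
    _ ≤ ‖f‖ * ‖y‖ := f.le_opNorm y
    _ ≤ ‖f‖ * ‖x‖ := by gcongr

theorem le_supIcc (f : StrongDual ℝ E) {x y : E} (hy : y ∈ Set.Icc 0 x) : f y ≤ supIcc f x :=
  le_csSup ⟨‖f‖ * ‖x‖, by rintro _ ⟨w, hw, rfl⟩; exact apply_le_of_mem f hw⟩ ⟨y, hy, rfl⟩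

theorem supIcc_le (f : StrongDual ℝ E) {x : E} (hx : 0 ≤ x) {c : ℝ}
    (h : ∀ y ∈ Set.Icc 0 x, f y ≤ c) : supIcc f x ≤ c :=
  csSup_le ⟨f 0, 0, ⟨le_rfl, hx⟩, rfl⟩ (by rintro _ ⟨w, hw, rfl⟩; exact h w hw)

theorem supIcc_nonneg (f : StrongDual ℝ E) {x : E} (hx : 0 ≤ x) : 0 ≤ supIcc f x := by
  simpa using le_supIcc f (y := 0) ⟨le_rfl, hx⟩

theorem supIcc_add (f : StrongDual ℝ E) {x y : E} (hx : 0 ≤ x) (hy : 0 ≤ y) :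
    supIcc f (x + y) = supIcc f x + supIcc f y := by
  apply le_antisymm
  · refine supIcc_le f (add_nonneg hx hy) fun z hz => ?_
    have h1 := le_supIcc f (x := x) (y := z ⊓ x) ⟨le_inf hz.1 hx, inf_le_right⟩
    have h2 := le_supIcc f (x := y) (y := z - z ⊓ x)
      ⟨nonneg_sub_inf z x, riesz_decomp hy hz.2⟩
    rw [map_sub] at h2
    linarith
  · have h1 : ∀ w ∈ Set.Icc 0 y, supIcc f x ≤ supIcc f (x + y) - f w := fun w hw =>
      supIcc_le f hx fun z hz => by
        have := le_supIcc f (x := x + y) (y := z + w)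
          ⟨add_nonneg hz.1 hw.1, add_le_add hz.2 hw.2⟩
        rw [map_add] at this
        linarith
    have h2 : supIcc f y ≤ supIcc f (x + y) - supIcc f x :=
      supIcc_le f hy fun w hw => by linarith [h1 w hw]
    linarith

theorem supIcc_sub_eq (f : StrongDual ℝ E) {a b : E} (ha : 0 ≤ a) (hb : 0 ≤ b) :
    supIcc f (a - b)⁺ - supIcc f (a - b)⁻ = supIcc f a - supIcc f b := by
  have h : (a - b)⁺ + b = a + (a - b)⁻ := by
    have := posPart_sub_negPart (a - b)
    rw [sub_eq_sub_iff_add_eq_add] at this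
    exact this
  have h' := congrArg (supIcc f) h
  rw [supIcc_add f (posPart_nonneg _) hb, supIcc_add f ha (negPart_nonneg _)] at h'
  linarith

/-- The positive part of a continuous functional. -/
noncomputable def dualPos (f : StrongDual ℝ E) : StrongDual ℝ E :=
  AddMonoidHom.toRealLinearMap
    (AddMonoidHom.mk' (fun x : E => supIcc f x⁺ - supIcc f x⁻) fun x y => by
      have h : x + y = (x⁺ + y⁺) - (x⁻ + y⁻) := by
        rw [add_sub_add_comm, posPart_sub_negPart, posPart_sub_negPart]
      rw [h, supIcc_sub_eq f (add_nonneg (posPart_nonneg _) (posPart_nonneg _))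
        (add_nonneg (negPart_nonneg _) (negPart_nonneg _)),
        supIcc_add f (posPart_nonneg _) (posPart_nonneg _),
        supIcc_add f (negPart_nonneg _) (negPart_nonneg _)]
      ring)
    (by
      refine AddMonoidHomClass.continuous_of_bound _ (‖f‖) fun x => ?_
      have key : ∀ z : E, 0 ≤ z → z ≤ |x| → supIcc f z ≤ ‖f‖ * ‖x‖ := fun z hz hzx =>
        supIcc_le f hz fun y hy => by
          have := apply_le_of_mem f (x := |x|) (y := y) ⟨hy.1, hy.2.trans hzx⟩
          rwa [norm_abs_eq_norm] at this
      have hp := key x⁺ (posPart_nonneg x) (sup_le (le_abs_self x) (abs_nonneg x))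
      have hn := key x⁻ (negPart_nonneg x) (sup_le (neg_le_abs x) (abs_nonneg x))
      have hp' := supIcc_nonneg f (posPart_nonneg x)
      have hn' := supIcc_nonneg f (negPart_nonneg x)
      change ‖supIcc f x⁺ - supIcc f x⁻‖ ≤ _
      rw [Real.norm_eq_abs, abs_le]
      constructor <;> linarith)

theorem dualPos_apply_of_nonneg (f : StrongDual ℝ E) {x : E} (hx : 0 ≤ x) :
    dualPos f x = sSup (f '' Set.Icc 0 x) := by
  change supIcc f x⁺ - supIcc f x⁻ = supIcc f x
  have h := supIcc_sub_eq f hx le_rfl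
  have h0 : supIcc f (0 : E) = 0 := by simp [supIcc]
  rw [sub_zero, h0, sub_zero] at h
  exact h

/-- The order of the dual: `f ≤ g` if and only if `f x ≤ g x` for all `x ≥ 0`. -/
instance instPartialOrderDual : PartialOrder (StrongDual ℝ E) where
  le f g := ∀ x : E, 0 ≤ x → f x ≤ g x
  le_refl _ _ _ := le_rfl
  le_trans _ _ _ h₁ h₂ x hx := (h₁ x hx).trans (h₂ x hx)
  le_antisymm f g h₁ h₂ := by
    ext x
    rw [← posPart_sub_negPart x, map_sub, map_sub,
      le_antisymm (h₁ _ (posPart_nonneg x)) (h₂ _ (posPart_nonneg x)),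
      le_antisymm (h₁ _ (negPart_nonneg x)) (h₂ _ (negPart_nonneg x))]

theorem dual_le_iff {f g : StrongDual ℝ E} : f ≤ g ↔ ∀ x : E, 0 ≤ x → f x ≤ g x := Iff.rfl

instance instIsOrderedAddMonoidDual : IsOrderedAddMonoid (StrongDual ℝ E) where
  add_le_add_left _ _ h _ x hx := add_le_add_left (h x hx) _

theorem isLUB_dualPos (f : StrongDual ℝ E) : IsLUB {f, 0} (dualPos f) := by
  constructor
  · rintro g (rfl | rfl) x hx
    · rw [dualPos_apply_of_nonneg _ hx]
      exact le_supIcc g ⟨hx, le_rfl⟩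
    · rw [dualPos_apply_of_nonneg _ hx]
      exact supIcc_nonneg f hx
  · intro g hg x hx
    rw [dualPos_apply_of_nonneg _ hx]
    refine supIcc_le f hx fun y hy => ?_
    have h1 : f y ≤ g y := hg (Set.mem_insert _ _) y hy.1
    have h2 : (0 : StrongDual ℝ E) (x - y) ≤ g (x - y) :=
      hg (Set.mem_insert_of_mem _ rfl) _ (sub_nonneg.2 hy.2)
    have h3 : (0 : ℝ) ≤ g (x - y) := h2
    rw [map_sub] at h3
    linarith

/-- The dual of a Banach lattice is a lattice: `f ⊔ g = g + (f - g)⁺`,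
`f ⊓ g = f - (f - g)⁺`. -/
noncomputable instance instLatticeDual : Lattice (StrongDual ℝ E) where
  sup f g := g + dualPos (f - g)
  le_sup_left f g := by
    have := (isLUB_dualPos (f - g)).1 (Set.mem_insert _ _)
    rwa [sub_le_iff_le_add'] at this
  le_sup_right f g :=
    le_add_of_nonneg_right ((isLUB_dualPos (f - g)).1 (Set.mem_insert_of_mem _ rfl))
  sup_le f g h hf hg := by
    rw [← le_sub_iff_add_le']
    refine (isLUB_dualPos (f - g)).2 ?_
    rintro k (rfl | rfl)
    · exact sub_le_sub_right hf g
    · exact sub_nonneg.2 hg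
  inf f g := f - dualPos (f - g)
  inf_le_left f g :=
    sub_le_self f ((isLUB_dualPos (f - g)).1 (Set.mem_insert_of_mem _ rfl))
  inf_le_right f g := by
    have := (isLUB_dualPos (f - g)).1 (Set.mem_insert _ _)
    rwa [sub_le_comm] at this
  le_inf h f g hf hg := by
    rw [le_sub_comm]
    refine (isLUB_dualPos (f - g)).2 ?_
    rintro k (rfl | rfl)
    · exact sub_le_sub_left hg f
    · exact sub_nonneg.2 hf

end Dual

/-! ### Operators, sequences and sets -/

/-- An operator is order bounded if it maps order intervals into order intervals. -/
def IsOrderBounded {E : Type u} {F : Type v} [NormedAddCommGroup E] [NormedSpace ℝ E] [Lattice E]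
    [NormedAddCommGroup F] [NormedSpace ℝ F] [Lattice F] (T : E →L[ℝ] F) : Prop :=
  ∀ a b : E, ∃ c d : F, T '' Set.Icc a b ⊆ Set.Icc c d

/-- An operator is positive if it maps the positive cone into the positive cone. -/
def IsPositiveOp {E : Type u} {F : Type v} [NormedAddCommGroup E] [NormedSpace ℝ E] [Lattice E]
    [NormedAddCommGroup F] [NormedSpace ℝ F] [Lattice F] (T : E →L[ℝ] F) : Prop :=
  ∀ x : E, 0 ≤ x → 0 ≤ T x

/-- A sequence in the dual converging to `0` in the weak* topology. -/
def WeakStarNull {X : Type u} [NormedAddCommGroup X] [NormedSpace ℝ X]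
    (f : ℕ → StrongDual ℝ X) : Prop :=
  Tendsto (fun n => StrongDual.toWeakDual (f n)) atTop (𝓝 0)

/-- A set whose closure in the weak topology is weakly compact. -/
def IsRelativelyWeaklyCompact {X : Type u} [NormedAddCommGroup X] [NormedSpace ℝ X]
    (W : Set X) : Prop :=
  IsCompact (closure (toWeakSpace ℝ X '' W))

/-- The terms of the sequence are pairwise disjoint elements of a vector lattice. -/
def IsDisjointSeq {G : Type u} [AddCommGroup G] [Lattice G] (f : ℕ → G) : Prop :=
  Pairwise fun n m => |f n| ⊓ |f m| = 0

/-- The norm is order continuous: `‖x_α‖ → 0` for every decreasing net `x_α ↓ 0`. Decreasing nets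
are given by their ranges, the nonempty downward directed sets; the norm being monotone on the
positive cone, `‖x_α‖ → 0` means that the range contains elements of arbitrarily small norm. -/
def HasOrderContinuousNorm (G : Type u) [NormedAddCommGroup G] [Lattice G] : Prop :=
  ∀ D : Set G, D.Nonempty → DirectedOn (· ≥ ·) D → IsGLB D 0 → ∀ ε : ℝ, 0 < ε → ∃ x ∈ D, ‖x‖ < ε

section Notions

variable {F : Type v} [NormedAddCommGroup F] [Lattice F] [HasSolidNorm F] [IsOrderedAddMonoid F]
  [NormedSpace ℝ F]

/-- A norm bounded set on which every disjoint weak* null sequence of functionals converges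
uniformly to `0`. -/
def IsAlmostLimitedSet (A : Set F) : Prop :=
  Bornology.IsBounded A ∧ ∀ f : ℕ → StrongDual ℝ F, IsDisjointSeq f → WeakStarNull f →
    TendstoUniformlyOn (fun n x => f n x) (fun _ => 0) atTop A

/-- `T` maps the closed unit ball to an almost limited set. -/
def IsAlmostLimitedOp {X : Type u} [NormedAddCommGroup X] [NormedSpace ℝ X]
    (T : X →L[ℝ] F) : Prop :=
  IsAlmostLimitedSet (T '' Metric.closedBall 0 1)

/-- `T` maps relatively weakly compact sets to almost limited sets. -/
def IsWeakAlmostLimitedOp {X : Type u} [NormedAddCommGroup X] [NormedSpace ℝ X]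
    (T : X →L[ℝ] F) : Prop :=
  ∀ W : Set X, IsRelativelyWeaklyCompact W → IsAlmostLimitedSet (T '' W)

variable (F)

/-- Property (d): `|f n|` is weak* null for every disjoint weak* null sequence `f` in the dual. -/
def HasPropertyD : Prop :=
  ∀ f : ℕ → StrongDual ℝ F, IsDisjointSeq f → WeakStarNull f → WeakStarNull fun n => |f n|

/-- Every weak* null sequence of positive functionals is norm null. -/
def HasPositiveDualSchur : Prop :=
  ∀ f : ℕ → StrongDual ℝ F, (∀ n, 0 ≤ f n) → WeakStarNull f →
    Tendsto (fun n => ‖f n‖) atTop (𝓝 0)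

end Notions

end BanachLattice

/-!
The implication from order bounded to positive operators is clear, as positive operators are order
bounded.

Suppose that `F` has the positive dual Schur property. By property (d) the moduli of a disjoint
weak* null sequence in `F*` are weak* null, so they are norm null, and every operator into `F` is
almost limited (`HasPositiveDualSchur.isAlmostLimitedOp`).

Suppose that the norm of `E*` is order continuous and that `T` is order bounded and weak almost
limited. For a disjoint weak* null sequence `f n` in `F*`, property (d) makes `|f n ∘ T|` weak*
null. If `‖f n ∘ T‖` did not tend to `0`, then `|f n ∘ T|` would be bounded below on a sequence in
the unit ball, which on a subsequence can be made disjoint (`exists_disjoint_of_le_apply`).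
Bounded disjoint sequences in `E` are weakly null
(`HasOrderContinuousNorm.tendsto_apply_of_disjoint`), so `T` maps this one to an almost limited
set, a contradiction (`IsWeakAlmostLimitedOp.isAlmostLimitedOp`).

If both conditions fail, there are positive functionals `φ n` on `E`, with order bounded partial
sums and norms bounded below (`exists_series_of_not_orderContinuous`), and positive `y n` in the
unit ball of `F` on which a disjoint weak* null sequence of positive functionals is bounded below
(`exists_disjoint_of_not_positiveDualSchur`). The operator `T x = ∑ φ n x • y n` is positive and
factors through `ℓ¹`, so by the Schur property (`tendsto_tsum_abs_of_tendsto_tsum_mul`) it maps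
relatively weakly compact sets to relatively norm compact ones and is weak almost limited. As
`T x ≥ φ n x • y n` for `x ≥ 0`, it is not almost limited.
-/

namespace BanachLattice

universe u v

set_option linter.unusedSectionVars false

/-! ### Disjointness in vector lattices -/

section VectorLattice

variable {G : Type u} [AddCommGroup G] [Lattice G] [IsOrderedAddMonoid G]

theorem inf_add_le_inf_add_inf {a b c : G} (ha : 0 ≤ a) (hb : 0 ≤ b) (hc : 0 ≤ c) :
    a ⊓ (b + c) ≤ a ⊓ b + a ⊓ c := by
  rw [add_inf, inf_add a b c]
  exact le_inf (inf_le_left.trans (le_add_of_nonneg_left (le_inf ha hb)))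
    (le_inf (inf_le_left.trans (le_add_of_nonneg_right hc)) inf_le_right)

theorem inf_sum_eq_zero {a : ℕ → G} (ha : ∀ i, 0 ≤ a i) {b : G} (hb : 0 ≤ b) (s : Finset ℕ)
    (h : ∀ i ∈ s, b ⊓ a i = 0) : b ⊓ ∑ i ∈ s, a i = 0 := by
  induction s using Finset.cons_induction with
  | empty => simpa using hb
  | cons j s hj ih =>
    rw [Finset.sum_cons]
    refine le_antisymm ?_ (le_inf hb (add_nonneg (ha j) (Finset.sum_nonneg fun i _ => ha i)))
    refine (inf_add_le_inf_add_inf hb (ha j) (Finset.sum_nonneg fun i _ => ha i)).trans ?_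
    rw [h j (Finset.mem_cons_self j s), ih fun i hi => h i (Finset.mem_cons_of_mem hi), add_zero]

/-- A sum of pairwise disjoint positive elements is their supremum. -/
theorem sum_le_of_pairwise_disjoint {a : ℕ → G} (ha : ∀ i, 0 ≤ a i)
    (hd : Pairwise fun i j => a i ⊓ a j = 0) {x : G} (hx : 0 ≤ x) (hax : ∀ i, a i ≤ x)
    (s : Finset ℕ) : ∑ i ∈ s, a i ≤ x := by
  induction s using Finset.cons_induction with
  | empty => simpa using hx
  | cons j s hj ih =>
    have h0 : a j ⊓ ∑ i ∈ s, a i = 0 := inf_sum_eq_zero ha (ha j) s fun i hi =>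
      hd (fun h => hj (h ▸ hi))
    rw [Finset.sum_cons, ← inf_add_sup, h0, zero_add]
    exact sup_le (hax j) ih

theorem inf_eq_zero_of_le {a b c d : G} (ha : 0 ≤ a) (hb : 0 ≤ b) (hac : a ≤ c) (hbd : b ≤ d)
    (h : c ⊓ d = 0) : a ⊓ b = 0 :=
  le_antisymm ((inf_le_inf hac hbd).trans_eq h) (le_inf ha hb)

theorem nsmul_inf_nsmul_eq_zero {a b : G} (ha : 0 ≤ a) (hb : 0 ≤ b) (h : a ⊓ b = 0) (m n : ℕ) :
    (m • a) ⊓ (n • b) = 0 := by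
  have key : ∀ {a b : G}, 0 ≤ a → 0 ≤ b → a ⊓ b = 0 → ∀ n : ℕ, a ⊓ (n • b) = 0 := by
    intro a b ha hb h n
    simpa using inf_sum_eq_zero (a := fun _ => b) (fun _ => hb) ha (Finset.range n) fun _ _ => h
  have h1 : (n • b) ⊓ a = 0 := by rw [inf_comm]; exact key ha hb h n
  rw [inf_comm]
  exact key (nsmul_nonneg hb n) ha h1 m

end VectorLattice

/-! ### Positive functionals and the modulus of a functional -/

section Dual

variable {E : Type u} [NormedAddCommGroup E] [Lattice E] [HasSolidNorm E] [IsOrderedAddMonoid E]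
  [NormedSpace ℝ E]

theorem norm_le_norm_of_nonneg_of_le {x y : E} (hx : 0 ≤ x) (hxy : x ≤ y) : ‖x‖ ≤ ‖y‖ :=
  norm_le_norm_of_abs_le_abs (by rwa [abs_of_nonneg hx, abs_of_nonneg (hx.trans hxy)])

theorem apply_nonneg {f : StrongDual ℝ E} (hf : 0 ≤ f) {x : E} (hx : 0 ≤ x) : 0 ≤ f x :=
  hf x hx

theorem apply_mono {f : StrongDual ℝ E} (hf : 0 ≤ f) {x y : E} (h : x ≤ y) : f x ≤ f y := by
  have := apply_nonneg hf (sub_nonneg.2 h)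
  rw [map_sub] at this
  linarith

theorem abs_apply_le (f : StrongDual ℝ E) (x : E) : |f x| ≤ |f| |x| := by
  have key : ∀ g : StrongDual ℝ E, g ≤ |f| → -g ≤ |f| → g x ≤ |f| |x| := by
    intro g h1 h2
    have hp := h1 _ (posPart_nonneg x)
    have hn := h2 _ (negPart_nonneg x)
    rw [← posPart_add_negPart x, map_add]
    nth_rw 1 [← posPart_sub_negPart x]
    rw [map_sub]
    change -(g x⁻) ≤ _ at hn
    linarith
  refine abs_le'.2 ⟨key f (le_abs_self f) (neg_le_abs f), ?_⟩
  simpa using key (-f) (neg_le_abs f) (by simpa using le_abs_self f)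

theorem norm_le_norm_abs (f : StrongDual ℝ E) : ‖f‖ ≤ ‖|f|‖ := by
  refine f.opNorm_le_bound (norm_nonneg _) fun x => ?_
  calc ‖f x‖ ≤ |f| |x| := abs_apply_le f x
    _ ≤ ‖|f| |x|‖ := Real.le_norm_self _
    _ ≤ ‖|f|‖ * ‖|x|‖ := (|f|).le_opNorm _
    _ = ‖|f|‖ * ‖x‖ := by rw [norm_abs_eq_norm x]

theorem dual_posPart_eq (f : StrongDual ℝ E) : f⁺ = dualPos f := by
  rw [posPart_def]
  change 0 + dualPos (f - 0) = _
  rw [zero_add, sub_zero]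

theorem exists_lt_apply_of_posPart {f : StrongDual ℝ E} {x : E} (hx : 0 ≤ x) {δ : ℝ}
    (hδ : 0 < δ) : ∃ u ∈ Set.Icc 0 x, f⁺ x < f u + δ := by
  rw [dual_posPart_eq, dualPos_apply_of_nonneg f hx]
  obtain ⟨_, ⟨u, hu, rfl⟩, h⟩ := exists_lt_of_lt_csSup
    (⟨f 0, 0, ⟨le_rfl, hx⟩, rfl⟩ : (f '' Set.Icc 0 x).Nonempty)
    (sub_lt_self (sSup (f '' Set.Icc 0 x)) hδ)
  exact ⟨u, hu, by linarith⟩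

/-- One half of the Riesz-Kantorovich formula `|f| x = sup {f u : |u| ≤ x}`. -/
theorem exists_abs_apply_lt {f : StrongDual ℝ E} {x : E} (hx : 0 ≤ x) {δ : ℝ} (hδ : 0 < δ) :
    ∃ u : E, |u| ≤ x ∧ |f| x < f u + δ := by
  obtain ⟨u, hu, hu'⟩ := exists_lt_apply_of_posPart (f := f) hx (half_pos hδ)
  obtain ⟨w, hw, hw'⟩ := exists_lt_apply_of_posPart (f := -f) hx (half_pos hδ)
  refine ⟨u - w, abs_le'.2 ⟨?_, ?_⟩, ?_⟩
  · exact (sub_le_self u hw.1).trans hu.2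
  · rw [neg_sub]
    exact (sub_le_self w hu.1).trans hw.2
  · rw [← posPart_add_negPart f, map_sub, ← posPart_neg]
    change f⁺ x + (-f)⁺ x < _
    change (-f)⁺ x < -(f w) + _ at hw'
    linarith

theorem exists_nonneg_lt_abs_apply {f : StrongDual ℝ E} {r : ℝ} (hr : r < ‖f‖) :
    ∃ x : E, 0 ≤ x ∧ ‖x‖ ≤ 1 ∧ r < |f| x := by
  obtain ⟨x, hx, h⟩ := f.exists_lt_apply_of_lt_opNorm hr
  exact ⟨|x|, abs_nonneg x, by rw [norm_abs_eq_norm]; exact hx.le, h.trans_le (abs_apply_le f x)⟩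

/-- A disjointness criterion in the dual, from `(f ⊓ g) x = inf {f u + g (x - u) : 0 ≤ u ≤ x}`. -/
theorem dual_inf_eq_zero {f g : StrongDual ℝ E} (hf : 0 ≤ f) (hg : 0 ≤ g)
    (h : ∀ x : E, 0 ≤ x → ∀ δ : ℝ, 0 < δ → ∃ u ∈ Set.Icc 0 x, f u ≤ δ ∧ g (x - u) ≤ δ) :
    f ⊓ g = 0 := by
  refine le_antisymm (fun x hx => le_of_forall_pos_le_add fun δ hδ => ?_) (le_inf hf hg)
  obtain ⟨u, hu, h1, h2⟩ := h x hx (δ / 2) (half_pos hδ)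
  have h3 : (f ⊓ g) u ≤ f u := (inf_le_left : f ⊓ g ≤ f) u hu.1
  have h4 : (f ⊓ g) (x - u) ≤ g (x - u) := (inf_le_right : f ⊓ g ≤ g) _ (sub_nonneg.2 hu.2)
  rw [map_sub] at h4
  change _ ≤ 0 + δ
  linarith

/-- A bounded additive function on the positive cone extends to a continuous functional, by
`x ↦ q x⁺ - q x⁻`. -/
theorem exists_dual_of_additive (q : E → ℝ)
    (hadd : ∀ x y : E, 0 ≤ x → 0 ≤ y → q (x + y) = q x + q y) (C : ℝ)
    (hC : ∀ x : E, 0 ≤ x → |q x| ≤ C * ‖x‖) :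
    ∃ g : StrongDual ℝ E, ∀ x : E, 0 ≤ x → g x = q x := by
  have hsub : ∀ a b : E, 0 ≤ a → 0 ≤ b → q (a - b)⁺ - q (a - b)⁻ = q a - q b := by
    intro a b ha hb
    have h : (a - b)⁺ + b = a + (a - b)⁻ := by
      rw [← sub_eq_sub_iff_add_eq_add, posPart_sub_negPart]
    have h' := congrArg q h
    rw [hadd _ _ (posPart_nonneg _) hb, hadd _ _ ha (negPart_nonneg _)] at h'
    linarith
  refine ⟨AddMonoidHom.toRealLinearMap
    (AddMonoidHom.mk' (fun x : E => q x⁺ - q x⁻) fun x y => ?_)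
    (AddMonoidHomClass.continuous_of_bound _ (2 * C) fun x => ?_), fun x hx => ?_⟩
  · have h : x + y = (x⁺ + y⁺) - (x⁻ + y⁻) := by
      rw [add_sub_add_comm, posPart_sub_negPart, posPart_sub_negPart]
    rw [h, hsub _ _ (add_nonneg (posPart_nonneg _) (posPart_nonneg _))
      (add_nonneg (negPart_nonneg _) (negPart_nonneg _)),
      hadd _ _ (posPart_nonneg _) (posPart_nonneg _),
      hadd _ _ (negPart_nonneg _) (negPart_nonneg _)]
    ring
  -- `C` is not assumed nonnegative; it is so as soon as some `z` has nonzero norm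
  · have key : ∀ z : E, 0 ≤ z → z ≤ |x| → |q z| ≤ C * ‖x‖ := by
      intro z hz hzx
      have h1 := norm_le_norm_of_nonneg_of_le hz hzx
      rw [norm_abs_eq_norm] at h1
      rcases eq_or_lt_of_le (norm_nonneg z) with h0 | h0
      · have h2 := hC z hz
        have h3 := hC |x| (abs_nonneg x)
        rw [norm_abs_eq_norm] at h3
        rw [← h0, mul_zero] at h2
        exact h2.trans ((abs_nonneg _).trans h3)
      · have h2 : 0 ≤ C := nonneg_of_mul_nonneg_left ((abs_nonneg _).trans (hC z hz)) h0
        exact (hC z hz).trans (by gcongr)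
    have hp := key x⁺ (posPart_nonneg x) (sup_le (le_abs_self x) (abs_nonneg x))
    have hn := key x⁻ (negPart_nonneg x) (sup_le (neg_le_abs x) (abs_nonneg x))
    change |q x⁺ - q x⁻| ≤ _
    calc |q x⁺ - q x⁻| ≤ |q x⁺| + |q x⁻| := abs_sub _ _
      _ ≤ 2 * C * ‖x‖ := by linarith
  · change q x⁺ - q x⁻ = q x
    have h0 : q 0 = 0 := by simpa using hadd 0 0 le_rfl le_rfl
    have h := hsub x 0 hx le_rfl
    rwa [sub_zero, h0, sub_zero] at h

/-- The part of a positive functional `f` carried by the band generated by `y`, namely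
`x ↦ sup_k f (x ⊓ k y)` for `x ≥ 0`. It vanishes on elements disjoint from `y` and, by the last
clause, is determined by its values on the ideal generated by `y`. -/
theorem exists_component {f : StrongDual ℝ E} (hf : 0 ≤ f) {y : E} (hy : 0 ≤ y) :
    ∃ g : StrongDual ℝ E, 0 ≤ g ∧ g ≤ f ∧ g y = f y ∧ (∀ x : E, 0 ≤ x → x ⊓ y = 0 → g x = 0) ∧
      ∀ x : E, 0 ≤ x → Tendsto (fun k : ℕ => g (x ⊓ k • y)) atTop (𝓝 (g x)) := by
  have hmono : ∀ x : E, Monotone fun k : ℕ => f (x ⊓ k • y) := fun x k l hkl =>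
    apply_mono hf (inf_le_inf_left x (nsmul_le_nsmul_left hy hkl))
  have hbdd : ∀ x : E, BddAbove (Set.range fun k : ℕ => f (x ⊓ k • y)) := fun x =>
    ⟨f x, by rintro _ ⟨k, rfl⟩; exact apply_mono hf inf_le_left⟩
  have hlim : ∀ x : E, Tendsto (fun k : ℕ => f (x ⊓ k • y)) atTop
      (𝓝 (⨆ k : ℕ, f (x ⊓ k • y))) := fun x => tendsto_atTop_ciSup (hmono x) (hbdd x)
  have hnn : ∀ x : E, 0 ≤ x → 0 ≤ ⨆ k : ℕ, f (x ⊓ k • y) := fun x hx =>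
    Real.iSup_nonneg fun k => apply_nonneg hf (le_inf hx (nsmul_nonneg hy k))
  have hle : ∀ x : E, ⨆ k : ℕ, f (x ⊓ k • y) ≤ f x := fun x =>
    ciSup_le fun k => apply_mono hf inf_le_left
  obtain ⟨g, hg⟩ := exists_dual_of_additive (fun x => ⨆ k : ℕ, f (x ⊓ k • y))
    (by
      intro a b ha hb
      apply le_antisymm
      · refine le_of_tendsto_of_tendsto' (hlim (a + b)) ((hlim a).add (hlim b)) fun k => ?_
        rw [← map_add]
        refine apply_mono hf ?_
        rw [inf_comm, inf_comm a, inf_comm b]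
        exact inf_add_le_inf_add_inf (nsmul_nonneg hy k) ha hb
      · refine le_of_tendsto' ((hlim a).add (hlim b)) fun k => ?_
        refine le_trans ?_ (le_ciSup (hbdd (a + b)) (k + k))
        rw [← map_add, add_nsmul]
        exact apply_mono hf (le_inf (add_le_add inf_le_left inf_le_left)
          (add_le_add inf_le_right inf_le_right))) ‖f‖
    (by
      intro x hx
      rw [abs_of_nonneg (hnn x hx)]
      exact (hle x).trans ((Real.le_norm_self _).trans (f.le_opNorm x)))
  have hge : ∀ x : E, 0 ≤ x → ∀ k : ℕ, g (x ⊓ k • y) = f (x ⊓ k • y) := by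
    intro x hx k
    rw [hg _ (le_inf hx (nsmul_nonneg hy k))]
    refine le_antisymm (hle _) ?_
    refine le_trans ?_ (le_ciSup (hbdd (x ⊓ k • y)) k)
    rw [inf_assoc, inf_idem]
  refine ⟨g, fun x hx => ?_, fun x hx => ?_, ?_, fun x hx hxy => ?_, fun x hx => ?_⟩
  · rw [hg x hx]; exact hnn x hx
  · rw [hg x hx]; exact hle x
  · simpa using hge y hy 1
  · rw [hg x hx]
    have h0 : ∀ k : ℕ, x ⊓ k • y = 0 := fun k => by
      simpa using nsmul_inf_nsmul_eq_zero hx hy hxy 1 k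
    simp [h0]
  · simp_rw [hge x hx]
    rw [hg x hx]
    exact hlim x

/-- For a disjoint sequence `y` of positive elements, positive functionals `f n` can be shrunk to
pairwise disjoint ones without changing the values `f n (y n)`. -/
theorem exists_disjoint_functionals {f : ℕ → StrongDual ℝ E} (hf : ∀ n, 0 ≤ f n) {y : ℕ → E}
    (hy : ∀ n, 0 ≤ y n) (hd : Pairwise fun n m => y n ⊓ y m = 0) :
    ∃ g : ℕ → StrongDual ℝ E, (∀ n, 0 ≤ g n) ∧ (∀ n, g n ≤ f n) ∧ (∀ n, g n (y n) = f n (y n)) ∧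
      Pairwise fun n m => g n ⊓ g m = 0 := by
  -- the witness `x - x ⊓ k y n` of disjointness is almost null for `g n`, and the rest of `x` is
  -- disjoint from `y m`
  choose g hg0 hgf hgy hgz hgt using fun n => exists_component (hf n) (hy n)
  refine ⟨g, hg0, hgf, hgy, fun n m hnm => ?_⟩
  refine dual_inf_eq_zero (hg0 n) (hg0 m) fun x hx δ hδ => ?_
  obtain ⟨k, hk⟩ := ((hgt n x hx).eventually_const_lt (sub_lt_self (g n x) hδ)).exists
  refine ⟨x - x ⊓ k • y n, ⟨sub_nonneg.2 inf_le_left,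
    sub_le_self _ (le_inf hx (nsmul_nonneg (hy n) k))⟩, ?_, ?_⟩
  · rw [map_sub]
    linarith
  · rw [sub_sub_cancel, hgz m _ (le_inf hx (nsmul_nonneg (hy n) k))]
    · exact hδ.le
    · refine inf_eq_zero_of_le (le_inf hx (nsmul_nonneg (hy n) k)) (hy m) inf_le_right le_rfl ?_
      simpa using nsmul_inf_nsmul_eq_zero (hy n) (hy m) (hd hnm) k 1

theorem weakStarNull_iff {X : Type u} [NormedAddCommGroup X] [NormedSpace ℝ X]
    {f : ℕ → StrongDual ℝ X} :
    WeakStarNull f ↔ ∀ x, Tendsto (fun n => f n x) atTop (𝓝 0) :=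
  WeakBilin.tendsto_iff_forall_eval_tendsto _ ContinuousLinearMap.coe_injective

theorem weakStarNull_of_nonneg {f : ℕ → StrongDual ℝ E}
    (h : ∀ x : E, 0 ≤ x → Tendsto (fun n => f n x) atTop (𝓝 0)) : WeakStarNull f := by
  refine weakStarNull_iff.2 fun x => ?_
  have := (h _ (posPart_nonneg x)).sub (h _ (negPart_nonneg x))
  simpa only [← map_sub, posPart_sub_negPart, sub_zero] using this

theorem WeakStarNull.of_le {f g : ℕ → StrongDual ℝ E} (hf : WeakStarNull f) (hg : ∀ n, 0 ≤ g n)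
    (hgf : ∀ n, g n ≤ f n) : WeakStarNull g :=
  weakStarNull_of_nonneg fun x hx => squeeze_zero (fun n => hg n x hx) (fun n => hgf n x hx)
    (weakStarNull_iff.1 hf x)

theorem WeakStarNull.exists_norm_le {X : Type u} [NormedAddCommGroup X] [NormedSpace ℝ X]
    [CompleteSpace X] {f : ℕ → StrongDual ℝ X} (hf : WeakStarNull f) : ∃ C, ∀ n, ‖f n‖ ≤ C :=
  banach_steinhaus fun x => by
    obtain ⟨C, hC⟩ := (weakStarNull_iff.1 hf x).norm.bddAbove_range
    exact ⟨C, fun n => hC ⟨n, rfl⟩⟩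

end Dual

/-! ### Disjoint sequences in a Banach lattice -/

section Disjointification

variable {E : Type u} [NormedAddCommGroup E] [Lattice E] [HasSolidNorm E] [IsOrderedAddMonoid E]
  [NormedSpace ℝ E]

/-- Both positive parts are dominated by those of `± (c a - b)`. -/
theorem posPart_inf_posPart_eq_zero [IsOrderedModule ℝ E] {a b u w : E} {c : ℝ} (hc : 1 ≤ c)
    (hu : u ≤ a - c⁻¹ • b) (hw : w ≤ b - c • a) : u⁺ ⊓ w⁺ = 0 := by
  have hc0 : 0 < c := zero_lt_one.trans_le hc
  have h1 : a - c⁻¹ • b = c⁻¹ • (c • a - b) := by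
    rw [smul_sub, smul_smul, inv_mul_cancel₀ hc0.ne', one_smul]
  refine inf_eq_zero_of_le (posPart_nonneg u) (posPart_nonneg w) ?_ ?_
    (posPart_inf_negPart_eq_zero (c • a - b))
  · refine sup_le ?_ (posPart_nonneg _)
    calc u ≤ c⁻¹ • (c • a - b) := h1 ▸ hu
      _ ≤ c⁻¹ • (c • a - b)⁺ :=
        smul_le_smul_of_nonneg_left (le_posPart _) (inv_nonneg.2 hc0.le)
      _ ≤ (c • a - b)⁺ := smul_le_of_le_one_left (posPart_nonneg _) (inv_le_one_of_one_le₀ hc)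
  · rw [← posPart_neg, neg_sub]
    exact posPart_mono hw

/-- Along a weak* null sequence of positive functionals `p`, a sequence `y` in the positive part of
the unit ball with `p n (y n)` bounded below can be replaced, on a subsequence, by smaller pairwise
disjoint elements. -/
theorem exists_disjoint_of_le_apply [CompleteSpace E] [IsOrderedModule ℝ E]
    {p : ℕ → StrongDual ℝ E} (hp : ∀ n, 0 ≤ p n) (hlim : WeakStarNull p) {y : ℕ → E}
    (hy : ∀ n, 0 ≤ y n) (hy1 : ∀ n, ‖y n‖ ≤ 1) {ε : ℝ} (hε : 0 < ε) (h : ∀ n, ε ≤ p n (y n)) :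
    ∃ (φ : ℕ → ℕ) (z : ℕ → E), StrictMono φ ∧ (∀ n, 0 ≤ z n) ∧ (∀ n, z n ≤ y (φ n)) ∧
      (Pairwise fun n m => z n ⊓ z m = 0) ∧ ∀ n, ε / 2 ≤ p (φ n) (z n) := by
  have hlim' := weakStarNull_iff.1 hlim
  let S : ℕ → E := fun k => ∑ j ∈ Finset.range (k + 1), y j
  have hS : ∀ {j k : ℕ}, j ≤ k → y j ≤ S k := fun {j k} hjk =>
    Finset.single_le_sum (fun i _ => hy i) (Finset.mem_range.2 (Nat.lt_succ_of_le hjk))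
  have hstep : ∀ k : ℕ, ∃ m, k < m ∧ p m ((2 : ℝ) ^ (k + 1) • S k) < ε / 4 := fun k =>
    ((eventually_gt_atTop k).and
      ((hlim' ((2 : ℝ) ^ (k + 1) • S k)).eventually_lt_const (by positivity))).exists
  choose next hnext hnext' using hstep
  -- on the indices `φ n`, the next functional is small on a large multiple of all previous `y j`
  let φ : ℕ → ℕ := fun n => next^[n] 0
  have hφs : ∀ n, φ (n + 1) = next (φ n) := fun n => Function.iterate_succ_apply' next n 0
  have hφ : StrictMono φ := strictMono_nat_of_lt_succ fun n => by rw [hφs]; exact hnext _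
  let t : ℕ → E := fun n => ((2 : ℝ) ^ n)⁻¹ • y (φ n)
  have ht0 : ∀ n, 0 ≤ t n := fun n => smul_nonneg (by positivity) (hy _)
  have htsum : Summable t := by
    refine Summable.of_norm_bounded (g := fun n : ℕ => ((1 : ℝ) / 2) ^ n)
      (summable_geometric_of_lt_one (by norm_num) (by norm_num)) fun n => ?_
    rw [norm_smul, norm_inv, norm_pow, Real.norm_ofNat, one_div, inv_pow]
    exact mul_le_of_le_one_right (by positivity) (hy1 _)
  let Y : E := ∑' n, t n
  have htY : ∀ n, t n ≤ Y := fun n => htsum.le_tsum n fun j _ => ht0 j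
  have hY : 0 ≤ Y := (ht0 0).trans (htY 0)
  -- Subtracting a large multiple of all earlier elements and `Y`, which dominates a positive
  -- multiple of each later one, makes the positive parts disjoint; `p (φ (n + 1))` is small on
  -- both subtracted terms.
  let w : ℕ → E := fun n => y (φ (n + 1)) - (2 : ℝ) ^ (φ n + 1) • S (φ n) - Y
  have hlt : ∀ {n m : ℕ}, n < m → (w n)⁺ ⊓ (w m)⁺ = 0 := by
    intro n m hnm
    refine posPart_inf_posPart_eq_zero (a := y (φ (n + 1))) (b := y (φ (m + 1)))
      (c := (2 : ℝ) ^ (m + 1)) (one_le_pow₀ (by norm_num)) ?_ ?_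
    · exact sub_le_sub (sub_le_self _ (smul_nonneg (by positivity)
        ((hy 0).trans (hS (Nat.zero_le _))))) (htY (m + 1))
    · refine (sub_le_self _ hY).trans (sub_le_sub_left ?_ _)
      calc (2 : ℝ) ^ (m + 1) • y (φ (n + 1)) ≤ (2 : ℝ) ^ (φ m + 1) • y (φ (n + 1)) :=
            smul_le_smul_of_nonneg_right
              (pow_le_pow_right₀ (by norm_num) (Nat.succ_le_succ (hφ.le_apply))) (hy _)
        _ ≤ (2 : ℝ) ^ (φ m + 1) • S (φ m) :=
            smul_le_smul_of_nonneg_left (hS (hφ.monotone hnm)) (by positivity)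
  obtain ⟨N, hN⟩ := eventually_atTop.1
    ((hlim' Y).eventually_lt_const (show (0 : ℝ) < ε / 4 by positivity))
  refine ⟨fun n => φ (n + N + 1), fun n => (w (n + N))⁺, fun a b hab => hφ (by omega),
    fun n => posPart_nonneg _, fun n => ?_, fun n m hnm => ?_, fun n => ?_⟩
  · refine sup_le ((sub_le_self _ hY).trans (sub_le_self _ ?_)) (hy _)
    exact smul_nonneg (by positivity) ((hy 0).trans (hS (Nat.zero_le _)))
  · rcases lt_or_gt_of_ne hnm with h' | h'
    · exact hlt (by omega)
    · rw [inf_comm]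
      exact hlt (by omega)
  · have h1 := apply_mono (hp (φ (n + N + 1))) (le_posPart (w (n + N)))
    have h2 : p (φ (n + N + 1)) (w (n + N)) = p (φ (n + N + 1)) (y (φ (n + N + 1))) -
        p (φ (n + N + 1)) ((2 : ℝ) ^ (φ (n + N) + 1) • S (φ (n + N))) - p (φ (n + N + 1)) Y := by
      rw [← map_sub, ← map_sub]
    have h3 := h (φ (n + N + 1))
    have h4 := hnext' (φ (n + N))
    rw [← hφs] at h4
    have h5 := hN (φ (n + N + 1)) (le_trans (by omega) hφ.le_apply)
    linarith

end Disjointification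

/-! ### Order bounded series of positive functionals -/

section Series

variable {E : Type u} [NormedAddCommGroup E] [Lattice E] [HasSolidNorm E] [IsOrderedAddMonoid E]
  [NormedSpace ℝ E] {φ : ℕ → StrongDual ℝ E} {ψ : StrongDual ℝ E}

theorem sum_abs_apply_le (hφ : ∀ n, 0 ≤ φ n) (hψ : ∀ n, ∑ i ∈ Finset.range n, φ i ≤ ψ) (x : E)
    (n : ℕ) : ∑ i ∈ Finset.range n, |φ i x| ≤ ψ |x| := by
  calc ∑ i ∈ Finset.range n, |φ i x| ≤ ∑ i ∈ Finset.range n, φ i |x| :=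
        Finset.sum_le_sum fun i _ => by
          simpa only [abs_of_nonneg (hφ i)] using abs_apply_le (φ i) x
    _ = (∑ i ∈ Finset.range n, φ i) |x| := (sum_apply ..).symm
    _ ≤ ψ |x| := hψ n |x| (abs_nonneg x)

theorem summable_abs_apply (hφ : ∀ n, 0 ≤ φ n) (hψ : ∀ n, ∑ i ∈ Finset.range n, φ i ≤ ψ)
    (x : E) : Summable fun n => |φ n x| :=
  summable_of_sum_range_le (fun _ => abs_nonneg _) (sum_abs_apply_le hφ hψ x)

/-- The operator `x ↦ ∑ φ n x • y n`; it factors through `ℓ¹`. -/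
theorem exists_hasSum_op (hφ : ∀ n, 0 ≤ φ n) (hψ : ∀ n, ∑ i ∈ Finset.range n, φ i ≤ ψ)
    {Y : Type v} [NormedAddCommGroup Y] [NormedSpace ℝ Y] [CompleteSpace Y] {y : ℕ → Y}
    (hy : ∀ n, ‖y n‖ ≤ 1) :
    ∃ T : E →L[ℝ] Y, ∀ x, HasSum (fun n => φ n x • y n) (T x) := by
  have hbd : ∀ x n, ‖φ n x • y n‖ ≤ |φ n x| := fun x n => by
    rw [norm_smul]
    exact mul_le_of_le_one_right (norm_nonneg _) (hy n)
  have hs : ∀ x, Summable fun n => φ n x • y n := fun x =>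
    Summable.of_norm_bounded (summable_abs_apply hφ hψ x) (hbd x)
  refine ⟨LinearMap.mkContinuous
    { toFun := fun x => ∑' n, φ n x • y n
      map_add' := fun a b => ?_
      map_smul' := fun c a => ?_ } ‖ψ‖ fun x => ?_, fun x => (hs x).hasSum⟩
  · rw [← (hs a).tsum_add (hs b)]
    simp only [map_add, add_smul]
  · rw [RingHom.id_apply, ← (hs a).tsum_const_smul c]
    simp only [map_smul, smul_eq_mul, mul_smul]
  · change ‖∑' n, φ n x • y n‖ ≤ _
    calc ‖∑' n, φ n x • y n‖ ≤ ∑' n, |φ n x| :=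
          tsum_of_norm_bounded (summable_abs_apply hφ hψ x).hasSum (hbd x)
      _ ≤ ψ |x| := (summable_abs_apply hφ hψ x).tsum_le_of_sum_range_le
          (sum_abs_apply_le hφ hψ x)
      _ ≤ ‖ψ‖ * ‖|x|‖ := (Real.le_norm_self _).trans (ψ.le_opNorm _)
      _ = ‖ψ‖ * ‖x‖ := by rw [norm_abs_eq_norm]

end Series

/-! ### Order continuity of the dual norm -/

section OrderContinuous

variable {E : Type u} [NormedAddCommGroup E] [Lattice E] [HasSolidNorm E] [IsOrderedAddMonoid E]
  [NormedSpace ℝ E]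

/-- If the dual norm is not order continuous, some order bounded series of positive functionals
has terms bounded away from `0` in norm: a norm Cauchy decreasing net with infimum `0` would
converge to `0`, and a net that is not Cauchy yields the terms as its differences. -/
theorem exists_series_of_not_orderContinuous (h : ¬ HasOrderContinuousNorm (StrongDual ℝ E)) :
    ∃ (φ : ℕ → StrongDual ℝ E) (ψ : StrongDual ℝ E) (δ : ℝ), 0 < δ ∧ (∀ n, 0 ≤ φ n) ∧
      (∀ n, ∑ i ∈ Finset.range n, φ i ≤ ψ) ∧ ∀ n, δ ≤ ‖φ n‖ := by
  unfold HasOrderContinuousNorm at h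
  push Not at h
  obtain ⟨D, hne, hdir, hglb, ε, hε, hD⟩ := h
  by_cases hC : ∃ δ : ℝ, 0 < δ ∧ ∀ d ∈ D, ∃ d' ∈ D, d' ≤ d ∧ δ ≤ ‖d - d'‖
  -- `D` is not Cauchy: iterate the choice of a smaller element at distance at least `δ`
  · obtain ⟨δ, hδ, hC⟩ := hC
    obtain ⟨d₀, hd₀⟩ := hne
    choose next hmem hle hnorm using hC
    let s : ℕ → D := fun n => (fun d : D => ⟨next d.1 d.2, hmem d.1 d.2⟩)^[n] ⟨d₀, hd₀⟩
    have hs : ∀ n, (s (n + 1)).1 = next (s n).1 (s n).2 := fun n => by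
      simp only [s, Function.iterate_succ_apply']
    refine ⟨fun n => (s n).1 - (s (n + 1)).1, d₀, δ, hδ, fun n => ?_, fun n => ?_, fun n => ?_⟩
    · change 0 ≤ (s n).1 - (s (n + 1)).1
      rw [hs]; exact sub_nonneg.2 (hle _ _)
    · rw [Finset.sum_range_sub']
      exact sub_le_self _ (hglb.1 (s n).2)
    · change δ ≤ ‖(s n).1 - (s (n + 1)).1‖
      rw [hs]; exact hnorm _ _
  -- `D` is Cauchy: its norm limit is a positive lower bound of `D`, hence `0`
  · exfalso
    push Not at hC
    choose e he hed using fun n : ℕ => hC ((1 / 2 : ℝ) ^ n) (by positivity)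
    have hcauchy : CauchySeq e := by
      refine cauchySeq_of_le_tendsto_0 (fun N : ℕ => (1 / 2 : ℝ) ^ N + (1 / 2 : ℝ) ^ N)
        (fun n m N hn hm => ?_) ?_
      · obtain ⟨c, hc, hc1, hc2⟩ := hdir (e n) (he n) (e m) (he m)
        have h1 := hed n c hc hc1
        have h2 := hed m c hc hc2
        have h3 : (1 / 2 : ℝ) ^ n ≤ (1 / 2) ^ N :=
          pow_le_pow_of_le_one (by norm_num) (by norm_num) hn
        have h4 : (1 / 2 : ℝ) ^ m ≤ (1 / 2) ^ N :=
          pow_le_pow_of_le_one (by norm_num) (by norm_num) hm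
        have h5 := dist_triangle_right (e n) (e m) c
        rw [dist_eq_norm (e n) c, dist_eq_norm (e m) c] at h5
        linarith
      · simpa using (tendsto_pow_atTop_nhds_zero_of_lt_one (r := (1 / 2 : ℝ)) (by norm_num)
          (by norm_num)).add (tendsto_pow_atTop_nhds_zero_of_lt_one (r := (1 / 2 : ℝ))
          (by norm_num) (by norm_num))
    obtain ⟨d, hd⟩ := cauchySeq_tendsto_of_complete hcauchy
    have happ : ∀ {s : ℕ → StrongDual ℝ E}, Tendsto s atTop (𝓝 d) → ∀ x : E,
        Tendsto (fun n => s n x) atTop (𝓝 (d x)) := fun hs x =>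
      ((ContinuousLinearMap.apply ℝ ℝ x).continuous.tendsto d).comp hs
    have hd0 : d ≤ 0 := by
      refine hglb.2 fun a ha x hx => ?_
      choose c hc hce hca using fun n : ℕ => hdir (e n) (he n) a ha
      have hcd : Tendsto c atTop (𝓝 d) := by
        have h1 : Tendsto (fun n => e n - c n) atTop (𝓝 0) :=
          squeeze_zero_norm (fun n => (hed n (c n) (hc n) (hce n)).le)
            (tendsto_pow_atTop_nhds_zero_of_lt_one (by norm_num) (by norm_num))
        simpa using hd.sub h1
      exact le_of_tendsto' (happ hcd x) fun n => hca n x hx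
    have hd1 : 0 ≤ d := fun x hx => ge_of_tendsto' (happ hd x) fun n => hglb.1 (he n) x hx
    have hd2 := ge_of_tendsto' hd.norm fun n => hD (e n) (he n)
    rw [le_antisymm hd0 hd1, norm_zero] at hd2
    linarith

/-- If the dual norm is order continuous, norm bounded disjoint sequences are weakly null. -/
theorem HasOrderContinuousNorm.tendsto_apply_of_disjoint
    (hE : HasOrderContinuousNorm (StrongDual ℝ E)) {u : ℕ → E} (hu : IsDisjointSeq u) {M : ℝ}
    (hM : ∀ n, ‖u n‖ ≤ M) (f : StrongDual ℝ E) : Tendsto (fun n => f (u n)) atTop (𝓝 0) := by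
  have hM0 : 0 ≤ M := (norm_nonneg _).trans (hM 0)
  obtain ⟨g, hg0, hgf, hgu, hgd⟩ := exists_disjoint_functionals (f := fun _ => |f|)
    (fun _ => abs_nonneg f) (fun n => abs_nonneg (u n)) hu
  have hsum : ∀ n, ∑ i ∈ Finset.range n, g i ≤ |f| := fun n =>
    sum_le_of_pairwise_disjoint hg0 hgd (abs_nonneg f) hgf _
  -- the tails `R N = ∑ k ≥ N, g k` decrease to `0`
  choose R hR using fun N : ℕ => exists_hasSum_op hg0 hsum (Y := ℝ)
    (y := fun k => if N ≤ k then 1 else 0) (fun k => by split_ifs <;> simp)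
  have hRanti : Antitone R := fun N K hNK x hx => by
    refine hasSum_le (fun k => ?_) (hR K x) (hR N x)
    refine smul_le_smul_of_nonneg_left ?_ (hg0 k x hx)
    split_ifs <;> first | omega | norm_num
  have hRlim : ∀ x, Tendsto (fun N => R N x) atTop (𝓝 0) := fun x => by
    have h := tendsto_tsum_of_dominated_convergence (𝓕 := atTop)
      (f := fun (N k : ℕ) => g k x • (if N ≤ k then (1 : ℝ) else 0)) (g := fun _ => (0 : ℝ))
      (summable_abs_apply hg0 hsum x)
      (fun k => tendsto_const_nhds.congr' ?_) (Eventually.of_forall fun N k => ?_)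
    · simpa only [(hR _ x).tsum_eq, tsum_zero] using h
    · filter_upwards [eventually_gt_atTop k] with N hN
      simp [not_le.2 hN]
    · split_ifs <;> simp
  have hglb : IsGLB (Set.range R) 0 := by
    refine ⟨?_, fun h hh x hx => ge_of_tendsto' (hRlim x) fun N => hh ⟨N, rfl⟩ x hx⟩
    rintro _ ⟨N, rfl⟩ x hx
    refine hasSum_le (fun k => ?_) hasSum_zero (hR N x)
    exact smul_nonneg (hg0 k x hx) (by split_ifs <;> norm_num)
  have hle : ∀ N n, N ≤ n → |f (u n)| ≤ ‖R N‖ * M := fun N n hn => by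
    calc |f (u n)| ≤ |f| |u n| := abs_apply_le f (u n)
      _ = g n |u n| := (hgu n).symm
      _ = g n |u n| • (if N ≤ n then (1 : ℝ) else 0) := by simp [hn]
      _ ≤ R N |u n| := le_hasSum (hR N |u n|) n fun k _ =>
          smul_nonneg (hg0 k _ (abs_nonneg _)) (by split_ifs <;> norm_num)
      _ ≤ ‖R N‖ * ‖|u n|‖ := (Real.le_norm_self _).trans ((R N).le_opNorm _)
      _ ≤ ‖R N‖ * M := by
          rw [norm_abs_eq_norm]
          gcongr
          exact hM n
  refine Metric.tendsto_atTop.2 fun ε hε => ?_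
  obtain ⟨_, ⟨N, rfl⟩, hN⟩ := hE (Set.range R) ⟨R 0, 0, rfl⟩
    (by
      rintro _ ⟨a, rfl⟩ _ ⟨b, rfl⟩
      exact ⟨R (max a b), ⟨_, rfl⟩, hRanti (le_max_left a b), hRanti (le_max_right a b)⟩)
    hglb (ε / (M + 1)) (by positivity)
  refine ⟨N, fun n hn => ?_⟩
  rw [Real.dist_eq, sub_zero]
  rw [lt_div_iff₀ (by positivity)] at hN
  nlinarith [hle N n hn, norm_nonneg (R N)]

end OrderContinuous

/-! ### The Schur property of `ℓ¹` and relatively weakly compact sets -/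

section Schur

/-- The Schur property of `ℓ¹`: the sequences `b n` converge to `0` coordinatewise and against
every `σ` in the unit ball of `ℓ^∞`, hence in norm. The unit ball of `ℓ^∞` is a compact space for
the product topology, and Baire's theorem makes the convergence uniform on a cylinder. -/
theorem tendsto_tsum_abs_of_tendsto_tsum_mul {b : ℕ → ℕ → ℝ}
    (hb : ∀ n, Summable fun k => |b n k|) (h0 : ∀ k, Tendsto (fun n => b n k) atTop (𝓝 0))
    (h : ∀ σ : ℕ → ℝ, (∀ k, |σ k| ≤ 1) →
      Tendsto (fun n => ∑' k, b n k * σ k) atTop (𝓝 0)) :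
    Tendsto (fun n => ∑' k, |b n k|) atTop (𝓝 0) := by
  have hσ : ∀ (σ : ℕ → Set.Icc (-1 : ℝ) 1) (k : ℕ), |(σ k : ℝ)| ≤ 1 := fun σ k =>
    abs_le.2 (σ k).2
  have hbd : ∀ (σ : ℕ → Set.Icc (-1 : ℝ) 1) (n k : ℕ), ‖b n k * (σ k : ℝ)‖ ≤ |b n k| :=
    fun σ n k => by
      rw [norm_mul]
      exact mul_le_of_le_one_right (abs_nonneg _) (hσ σ k)
  have hsum : ∀ (σ : ℕ → Set.Icc (-1 : ℝ) 1) (n : ℕ), Summable fun k => b n k * (σ k : ℝ) :=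
    fun σ n => Summable.of_norm_bounded (hb n) (hbd σ n)
  have hcont : ∀ n, Continuous fun σ : ℕ → Set.Icc (-1 : ℝ) 1 => ∑' k, b n k * (σ k : ℝ) :=
    fun n => continuous_tsum (fun k => by fun_prop) (hb n) fun k σ => hbd σ n k
  refine Metric.tendsto_atTop.2 fun ε hε => ?_
  let F : ℕ → Set (ℕ → Set.Icc (-1 : ℝ) 1) := fun N =>
    ⋂ n ≥ N, {σ | |∑' k, b n k * (σ k : ℝ)| ≤ ε / 3}
  have hFc : ∀ N, IsClosed (F N) := fun N =>
    isClosed_biInter fun n _ => isClosed_le (hcont n).abs continuous_const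
  have hFu : ⋃ N, F N = Set.univ := by
    refine Set.eq_univ_of_forall fun σ => ?_
    obtain ⟨N, hN⟩ := Metric.tendsto_atTop.1 (h (fun k => σ k) (hσ σ)) (ε / 3) (by positivity)
    refine Set.mem_iUnion.2 ⟨N, Set.mem_iInter₂.2 fun n hn => ?_⟩
    have := (hN n hn).le
    rwa [Real.dist_eq, sub_zero] at this
  have : Nonempty (ℕ → Set.Icc (-1 : ℝ) 1) := ⟨fun _ => ⟨0, by norm_num⟩⟩
  obtain ⟨N, σ₀, hσ₀⟩ := nonempty_interior_of_iUnion_of_closed hFc hFu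
  obtain ⟨I, U, hU, hIU⟩ := isOpen_pi_iff.1 isOpen_interior σ₀ hσ₀
  have hI : Tendsto (fun n => ∑ k ∈ I, 2 * |b n k|) atTop (𝓝 0) := by
    simpa using tendsto_finsetSum I fun k _ => ((h0 k).abs.const_mul 2)
  obtain ⟨K, hK⟩ := eventually_atTop.1
    (hI.eventually_lt_const (show (0 : ℝ) < ε / 3 by positivity))
  refine ⟨max N K, fun n hn => ?_⟩
  have hsign : ∀ r : ℝ, (SignType.sign r : ℝ) ∈ Set.Icc (-1 : ℝ) 1 := fun r => by
    rcases lt_trichotomy r 0 with hr | rfl | hr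
    · simp [sign_neg hr]
    · simp
    · simp [sign_pos hr]
  -- `τ` agrees with `σ₀` on the coordinates in `I` and with the signs of `b n` elsewhere
  let τ : ℕ → Set.Icc (-1 : ℝ) 1 := fun k => if k ∈ I then σ₀ k else ⟨_, hsign (b n k)⟩
  have hτ : τ ∈ F N := interior_subset (hIU fun k hk => by
    have : τ k = σ₀ k := if_pos hk
    rw [this]
    exact (hU k hk).2)
  have h1 : |∑' k, b n k * (τ k : ℝ)| ≤ ε / 3 :=
    Set.mem_iInter₂.1 hτ n (le_of_max_le_left hn)
  have h2 : ∑' k, |b n k| - ∑' k, b n k * (τ k : ℝ) =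
      ∑ k ∈ I, (|b n k| - b n k * (τ k : ℝ)) := by
    rw [← (hb n).tsum_sub (hsum τ n)]
    refine tsum_eq_sum fun k hk => ?_
    simp only [τ, if_neg hk]
    rw [mul_comm, sign_mul_self, sub_self]
  have h3 : ∑ k ∈ I, (|b n k| - b n k * (τ k : ℝ)) ≤ ∑ k ∈ I, 2 * |b n k| :=
    Finset.sum_le_sum fun k _ => by
      have := (abs_le.1 (hbd τ n k)).1
      linarith
  have h4 := hK n (le_of_max_le_right hn)
  have h5 := (abs_le.1 h1).2
  rw [Real.dist_eq, sub_zero, abs_of_nonneg (tsum_nonneg fun k => abs_nonneg _)]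
  linarith

end Schur

section WeaklyCompact

variable {X : Type u} [NormedAddCommGroup X] [NormedSpace ℝ X]

theorem continuous_apply_toWeakSpace_symm (f : StrongDual ℝ X) :
    Continuous fun w : WeakSpace ℝ X => f ((toWeakSpace ℝ X).symm w) :=
  WeakBilin.eval_continuous _ f

/-- Each functional is bounded on `W`, so the uniform boundedness principle applies in the
bidual. -/
theorem IsRelativelyWeaklyCompact.isBounded {W : Set X} (hW : IsRelativelyWeaklyCompact W) :
    Bornology.IsBounded W := by
  obtain ⟨C, hC⟩ := banach_steinhaus
    (g := fun x : W => NormedSpace.inclusionInDoubleDual ℝ X x.1) fun f => by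
      obtain ⟨C, hC⟩ := (hW.image (continuous_apply_toWeakSpace_symm f)).isBounded.exists_norm_le
      refine ⟨C, fun x => hC _ ⟨toWeakSpace ℝ X x.1, subset_closure ⟨x.1, x.2, rfl⟩, ?_⟩⟩
      simp
  refine isBounded_iff_forall_norm_le.2 ⟨C, fun x hx => ?_⟩
  have := hC ⟨x, hx⟩
  rwa [← (NormedSpace.inclusionInDoubleDualLi ℝ (E := X)).norm_map x]

theorem isRelativelyWeaklyCompact_range {u : ℕ → X}
    (hu : ∀ f : StrongDual ℝ X, Tendsto (fun n => f (u n)) atTop (𝓝 0)) :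
    IsRelativelyWeaklyCompact (Set.range u) := by
  have h : Tendsto (fun n => toWeakSpace ℝ X (u n)) atTop (𝓝 (toWeakSpace ℝ X 0)) := by
    refine (WeakBilin.tendsto_iff_forall_eval_tendsto (topDualPairing ℝ X).flip ?_).2 fun f => ?_
    · exact fun x y hxy => (SeparatingDual.eq_iff_forall_dual_eq (R := ℝ)).2 fun f =>
        LinearMap.congr_fun hxy f
    · change Tendsto (fun n => f (u n)) atTop (𝓝 (f 0))
      simpa using hu f
  refine h.isCompact_insert_range.of_isClosed_subset isClosed_closure
    (closure_minimal ?_ h.isCompact_insert_range.isClosed)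
  rintro _ ⟨_, ⟨n, rfl⟩, rfl⟩
  exact Set.mem_insert_of_mem _ ⟨n, rfl⟩

end WeaklyCompact

section Series

variable {E : Type u} [NormedAddCommGroup E] [Lattice E] [HasSolidNorm E] [IsOrderedAddMonoid E]
  [NormedSpace ℝ E] {φ : ℕ → StrongDual ℝ E} {ψ : StrongDual ℝ E}

/-- An order bounded series of positive functionals maps relatively weakly compact sets to
relatively norm compact subsets of `ℓ¹`. -/
theorem exists_subseq_tendsto_tsum_abs (hφ : ∀ n, 0 ≤ φ n)
    (hψ : ∀ n, ∑ i ∈ Finset.range n, φ i ≤ ψ) {W : Set E} (hW : IsRelativelyWeaklyCompact W)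
    {x : ℕ → E} (hx : ∀ n, x n ∈ W) :
    ∃ (a : E) (θ : ℕ → ℕ), StrictMono θ ∧
      Tendsto (fun n => ∑' k, |φ k (x (θ n) - a)|) atTop (𝓝 0) := by
  let K : Set (WeakSpace ℝ E) := closure (toWeakSpace ℝ E '' W)
  have hK : IsCompact K := hW
  have hmem : ∀ n, toWeakSpace ℝ E (x n) ∈ K := fun n => subset_closure ⟨x n, hx n, rfl⟩
  let Φ : WeakSpace ℝ E → ℕ → ℝ := fun w k => φ k ((toWeakSpace ℝ E).symm w)
  have hΦ : Continuous Φ := continuous_pi fun k => continuous_apply_toWeakSpace_symm (φ k)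
  obtain ⟨_, ⟨w, hw, rfl⟩, θ, hθ, hlim⟩ := (hK.image hΦ).tendsto_subseq
    (x := fun n => Φ (toWeakSpace ℝ E (x n))) fun n => ⟨_, hmem n, rfl⟩
  set a : E := (toWeakSpace ℝ E).symm w with ha
  have hcoord : ∀ k, Tendsto (fun n => φ k (x (θ n))) atTop (𝓝 (φ k a)) := fun k => by
    simpa [Φ] using tendsto_pi_nhds.1 hlim k
  refine ⟨a, θ, hθ, tendsto_tsum_abs_of_tendsto_tsum_mul
    (fun n => summable_abs_apply hφ hψ _) (fun k => ?_) fun σ hσ => ?_⟩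
  · simpa using (hcoord k).sub_const (φ k a)
  · obtain ⟨T, hT⟩ := exists_hasSum_op hφ hψ (Y := ℝ) (y := σ) hσ
    have hTx : ∀ n, ∑' k, φ k (x (θ n) - a) * σ k = T (x (θ n)) - T a := fun n => by
      rw [← map_sub]
      exact (hT _).tsum_eq
    simp_rw [hTx]
    suffices Tendsto (fun n => T (x (θ n))) atTop (𝓝 (T a)) by
      simpa using this.sub_const (T a)
    -- every weak cluster point of the subsequence has the same coordinates as `a`
    refine (tendsto_iff_ultrafilter _ _ _).2 fun U hU => ?_
    obtain ⟨w', -, hw'⟩ := isCompact_iff_ultrafilter_le_nhds.1 hK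
      (U.map fun n => toWeakSpace ℝ E (x (θ n)))
      (tendsto_principal.2 (Eventually.of_forall fun n => hmem (θ n)))
    have hlim' : ∀ f : StrongDual ℝ E, Tendsto (fun n => f (x (θ n))) U
        (𝓝 (f ((toWeakSpace ℝ E).symm w'))) := fun f =>
      (((continuous_apply_toWeakSpace_symm f).tendsto w').comp
        (show Tendsto (fun n => toWeakSpace ℝ E (x (θ n))) U (𝓝 w') from hw'))
    have heq : T ((toWeakSpace ℝ E).symm w') = T a := by
      refine (hT _).unique ?_
      have : ∀ k, φ k ((toWeakSpace ℝ E).symm w') = φ k a := fun k =>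
        tendsto_nhds_unique (hlim' (φ k)) ((hcoord k).mono_left hU)
      simp_rw [this]
      exact hT a
    rw [← heq]
    exact hlim' T

end Series

/-! ### Almost limited sets and operators -/

section AlmostLimited

variable {F : Type v} [NormedAddCommGroup F] [Lattice F] [HasSolidNorm F] [IsOrderedAddMonoid F]
  [NormedSpace ℝ F]

theorem IsDisjointSeq.of_nonneg {G : Type u} [AddCommGroup G] [Lattice G] [IsOrderedAddMonoid G]
    {f : ℕ → G} (hf : ∀ n, 0 ≤ f n) (h : Pairwise fun n m => f n ⊓ f m = 0) :
    IsDisjointSeq f := fun n m hnm => by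
  change |f n| ⊓ |f m| = 0
  rw [abs_of_nonneg (hf n), abs_of_nonneg (hf m)]
  exact h hnm

theorem IsPositiveOp.isOrderBounded {E : Type u} [NormedAddCommGroup E] [NormedSpace ℝ E]
    [Lattice E] [IsOrderedAddMonoid E] {T : E →L[ℝ] F} (hT : IsPositiveOp T) :
    IsOrderBounded T := fun a b => ⟨T a, T b, by
  rintro _ ⟨x, hx, rfl⟩
  have h1 := hT _ (sub_nonneg.2 hx.1)
  have h2 := hT _ (sub_nonneg.2 hx.2)
  rw [map_sub] at h1 h2
  exact ⟨sub_nonneg.1 h1, sub_nonneg.1 h2⟩⟩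

/-- Relatively norm compact sets are almost limited, as weak* null sequences are norm bounded and
converge uniformly on such sets. -/
theorem IsAlmostLimitedSet.of_subseq [CompleteSpace F] {A : Set F} (hA : Bornology.IsBounded A)
    (h : ∀ x : ℕ → F, (∀ n, x n ∈ A) →
      ∃ (a : F) (θ : ℕ → ℕ), StrictMono θ ∧ Tendsto (fun n => x (θ n)) atTop (𝓝 a)) :
    IsAlmostLimitedSet A := by
  refine ⟨hA, fun f _ hf => ?_⟩
  obtain ⟨C, hC⟩ := hf.exists_norm_le
  refine Metric.tendstoUniformlyOn_iff.2 fun ε hε => ?_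
  by_contra hcon
  obtain ⟨ρ, hρ, hρ'⟩ := extraction_of_frequently_atTop (not_eventually.1 hcon)
  push Not at hρ'
  choose x hxA hx using hρ'
  obtain ⟨a, θ, hθ, hlim⟩ := h x hxA
  have h1 : Tendsto (fun n => C * ‖x (θ n) - a‖ + |f (ρ (θ n)) a|) atTop (𝓝 0) := by
    have h2 := (tendsto_iff_norm_sub_tendsto_zero.1 hlim).const_mul C
    have h3 := ((weakStarNull_iff.1 hf a).abs).comp (hρ.comp hθ).tendsto_atTop
    simpa using h2.add h3
  obtain ⟨n, hn⟩ := (h1.eventually_lt_const hε).exists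
  have h2 := hx (θ n)
  rw [dist_comm, Real.dist_eq, sub_zero] at h2
  have h3 : |f (ρ (θ n)) (x (θ n) - a)| ≤ C * ‖x (θ n) - a‖ :=
    ((f (ρ (θ n))).le_opNorm _).trans (by gcongr; exact hC _)
  have h4 : f (ρ (θ n)) (x (θ n)) = f (ρ (θ n)) (x (θ n) - a) + f (ρ (θ n)) a := by
    rw [← map_add, sub_add_cancel]
  have h5 := abs_add_le (f (ρ (θ n)) (x (θ n) - a)) (f (ρ (θ n)) a)
  rw [← h4] at h5
  linarith

theorem IsAlmostLimitedOp.of_tendsto_norm {X : Type u} [NormedAddCommGroup X] [NormedSpace ℝ X]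
    {T : X →L[ℝ] F} (h : ∀ f : ℕ → StrongDual ℝ F, IsDisjointSeq f → WeakStarNull f →
      Tendsto (fun n => ‖(f n).comp T‖) atTop (𝓝 0)) : IsAlmostLimitedOp T := by
  refine ⟨T.lipschitz.isBounded_image Metric.isBounded_closedBall, fun f hfd hf => ?_⟩
  refine Metric.tendstoUniformlyOn_iff.2 fun ε hε => ?_
  filter_upwards [(h f hfd hf).eventually_lt_const hε] with n hn
  rintro _ ⟨x, hx, rfl⟩
  rw [dist_comm, Real.dist_eq, sub_zero]
  refine lt_of_le_of_lt ?_ hn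
  exact ((f n).comp T).unit_le_opNorm x (by simpa using hx)

theorem HasPositiveDualSchur.isAlmostLimitedOp (hS : HasPositiveDualSchur F)
    (hd : HasPropertyD F) {X : Type u} [NormedAddCommGroup X] [NormedSpace ℝ X]
    (T : X →L[ℝ] F) : IsAlmostLimitedOp T := by
  refine .of_tendsto_norm fun f hfd hf => ?_
  have h := (hS _ (fun n => abs_nonneg (f n)) (hd f hfd hf)).mul_const ‖T‖
  rw [zero_mul] at h
  exact squeeze_zero (fun _ => norm_nonneg _)
    (fun n => ((f n).opNorm_comp_le T).trans (by gcongr; exact norm_le_norm_abs _)) h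

variable {E : Type u} [NormedAddCommGroup E] [Lattice E] [HasSolidNorm E] [IsOrderedAddMonoid E]
  [NormedSpace ℝ E]

/-- For order bounded `T`, the adjoint maps a disjoint weak* null sequence to a sequence whose
moduli are weak* null. -/
theorem IsOrderBounded.weakStarNull_abs_comp {T : E →L[ℝ] F} (hT : IsOrderBounded T)
    (hd : HasPropertyD F) {f : ℕ → StrongDual ℝ F} (hfd : IsDisjointSeq f)
    (hf : WeakStarNull f) : WeakStarNull fun n => |(f n).comp T| := by
  refine weakStarNull_of_nonneg fun x hx => ?_
  obtain ⟨c, d, hcd⟩ := hT (-x) x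
  refine squeeze_zero (fun n => abs_nonneg ((f n).comp T) x hx) (fun n => ?_)
    (weakStarNull_iff.1 (hd f hfd hf) (|c| + |d|))
  refine le_of_forall_pos_le_add fun δ hδ => ?_
  obtain ⟨u, hu, hlt⟩ := exists_abs_apply_lt (f := (f n).comp T) hx hδ
  have hTu := hcd ⟨u, ⟨neg_le.1 ((neg_le_abs u).trans hu), (le_abs_self u).trans hu⟩, rfl⟩
  have h1 : |T u| ≤ |c| + |d| := by
    refine abs_le'.2 ⟨hTu.2.trans ((le_abs_self d).trans
      (le_add_of_nonneg_left (abs_nonneg c))), ?_⟩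
    exact (neg_le_neg hTu.1).trans ((neg_le_abs c).trans (le_add_of_nonneg_right (abs_nonneg d)))
  have h2 := apply_mono (abs_nonneg (f n)) h1
  have h3 := (le_abs_self (f n (T u))).trans (abs_apply_le (f n) (T u))
  change _ < f n (T u) + δ at hlt
  linarith

/-- If `‖f n ∘ T‖` stayed away from `0`, it would do so on a disjoint bounded sequence `u`; but `u`
is weakly null by order continuity, so its image under `T` is almost limited. -/
theorem IsWeakAlmostLimitedOp.isAlmostLimitedOp [CompleteSpace E] [IsOrderedModule ℝ E]
    {T : E →L[ℝ] F} (hW : IsWeakAlmostLimitedOp T) (hT : IsOrderBounded T)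
    (hd : HasPropertyD F) (hE : HasOrderContinuousNorm (StrongDual ℝ E)) :
    IsAlmostLimitedOp T := by
  refine .of_tendsto_norm fun f hfd hf => ?_
  by_contra hcon
  rw [Metric.tendsto_nhds] at hcon
  push Not at hcon
  obtain ⟨ε, hε, hcon⟩ := hcon
  obtain ⟨ρ, hρ, hρ'⟩ := extraction_of_frequently_atTop hcon
  have hnorm : ∀ n, ε / 2 < ‖(f (ρ n)).comp T‖ := fun n => by
    have := hρ' n
    rw [Real.dist_eq, sub_zero, abs_of_nonneg (norm_nonneg _)] at this
    linarith
  choose y hy hy1 hyε using fun n => exists_nonneg_lt_abs_apply (hnorm n)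
  have habs : WeakStarNull fun n => |(f (ρ n)).comp T| :=
    weakStarNull_iff.2 fun x =>
      (weakStarNull_iff.1 (hT.weakStarNull_abs_comp hd hfd hf) x).comp hρ.tendsto_atTop
  obtain ⟨φ, z, hφ, hz0, hzy, hzd, hz⟩ := exists_disjoint_of_le_apply
    (fun n => abs_nonneg ((f (ρ n)).comp T)) habs hy hy1 (half_pos hε) fun n => (hyε n).le
  choose u huz hu using fun n => exists_abs_apply_lt (f := (f (ρ (φ n))).comp T) (hz0 n)
    (show 0 < ε / 8 by positivity)
  have hud : IsDisjointSeq u := fun n m hnm =>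
    inf_eq_zero_of_le (abs_nonneg _) (abs_nonneg _) (huz n) (huz m) (hzd hnm)
  have hu1 : ∀ n, ‖u n‖ ≤ 1 := fun n => by
    rw [← norm_abs_eq_norm]
    exact (norm_le_norm_of_nonneg_of_le (abs_nonneg _) ((huz n).trans (hzy n))).trans (hy1 _)
  have hunif := (hW _ (isRelativelyWeaklyCompact_range
    (hE.tendsto_apply_of_disjoint hud hu1))).2 f hfd hf
  obtain ⟨N, hN⟩ := eventually_atTop.1
    (Metric.tendstoUniformlyOn_iff.1 hunif (ε / 8) (by positivity))
  have h1 := hN (ρ (φ N)) ((hρ.comp hφ).le_apply) (T (u N)) ⟨u N, ⟨N, rfl⟩, rfl⟩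
  rw [dist_comm, Real.dist_eq, sub_zero] at h1
  have h2 := hu N
  have h3 := hz N
  have h4 := le_abs_self (f (ρ (φ N)) (T (u N)))
  change _ < f (ρ (φ N)) (T (u N)) + _ at h2
  linarith

/-- If `F` fails the positive dual Schur property, a disjoint weak* null sequence of positive
functionals is bounded below on some bounded positive sequence. -/
theorem exists_disjoint_of_not_positiveDualSchur [CompleteSpace F] [IsOrderedModule ℝ F]
    (h : ¬ HasPositiveDualSchur F) :
    ∃ (g : ℕ → StrongDual ℝ F) (y : ℕ → F) (ε : ℝ), 0 < ε ∧ (∀ n, 0 ≤ g n) ∧ IsDisjointSeq g ∧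
      WeakStarNull g ∧ (∀ n, 0 ≤ y n) ∧ (∀ n, ‖y n‖ ≤ 1) ∧ ∀ n, ε ≤ g n (y n) := by
  unfold HasPositiveDualSchur at h
  push Not at h
  obtain ⟨f, hf0, hf, hcon⟩ := h
  rw [Metric.tendsto_nhds] at hcon
  push Not at hcon
  obtain ⟨ε, hε, hcon⟩ := hcon
  obtain ⟨ρ, hρ, hρ'⟩ := extraction_of_frequently_atTop hcon
  have hnorm : ∀ n, ε / 2 < ‖f (ρ n)‖ := fun n => by
    have := hρ' n
    rw [Real.dist_eq, sub_zero, abs_of_nonneg (norm_nonneg _)] at this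
    linarith
  choose y hy hy1 hyε using fun n => exists_nonneg_lt_abs_apply (hnorm n)
  obtain ⟨φ, z, hφ, hz0, hzy, hzd, hz⟩ := exists_disjoint_of_le_apply
    (p := fun n => f (ρ n)) (fun n => hf0 _)
    (weakStarNull_iff.2 fun x => (weakStarNull_iff.1 hf x).comp hρ.tendsto_atTop) hy hy1
    (half_pos hε) fun n => by simpa only [abs_of_nonneg (hf0 (ρ n))] using (hyε n).le
  obtain ⟨g, hg0, hgf, hgz, hgd⟩ := exists_disjoint_functionals
    (f := fun n => f (ρ (φ n))) (fun n => hf0 _) hz0 hzd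
  refine ⟨g, z, ε / 2 / 2, by positivity, hg0, .of_nonneg hg0 hgd, ?_, hz0, fun n => ?_,
    fun n => (hz n).trans_eq (hgz n).symm⟩
  · exact WeakStarNull.of_le (weakStarNull_iff.2 fun x =>
      (weakStarNull_iff.1 hf x).comp (hρ.comp hφ).tendsto_atTop) hg0 hgf
  · exact (norm_le_norm_of_nonneg_of_le (hz0 n) (hzy n)).trans (hy1 _)

/-- The operator `x ↦ ∑ φ n x • y n`, with an order bounded series of functionals `φ n` that is
not norm null and `y n` on which a disjoint weak* null sequence is bounded below. It factors through
`ℓ¹`, hence maps relatively weakly compact sets to relatively norm compact ones. -/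
theorem exists_positive_weakAlmostLimited_not_almostLimited [CompleteSpace F]
    [IsOrderedModule ℝ F] (hS : ¬ HasPositiveDualSchur F)
    (hE : ¬ HasOrderContinuousNorm (StrongDual ℝ E)) :
    ∃ T : E →L[ℝ] F, IsPositiveOp T ∧ IsWeakAlmostLimitedOp T ∧ ¬ IsAlmostLimitedOp T := by
  obtain ⟨φ, ψ, δ, hδ, hφ0, hψ, hφδ⟩ := exists_series_of_not_orderContinuous hE
  obtain ⟨g, y, ε, hε, hg0, hgd, hg, hy0, hy1, hgy⟩ := exists_disjoint_of_not_positiveDualSchur hS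
  obtain ⟨T, hT⟩ := exists_hasSum_op hφ0 hψ hy1
  have hterm : ∀ x : E, 0 ≤ x → ∀ n, 0 ≤ φ n x • y n := fun x hx n =>
    smul_nonneg (hφ0 n x hx) (hy0 n)
  refine ⟨T, fun x hx => hasSum_le (hterm x hx) hasSum_zero (hT x), fun W hW => ?_, fun hAL => ?_⟩
  · refine .of_subseq (T.lipschitz.isBounded_image hW.isBounded) fun w hw => ?_
    choose x hxW hxw using hw
    obtain ⟨a, θ, hθ, hlim⟩ := exists_subseq_tendsto_tsum_abs hφ0 hψ hW hxW
    refine ⟨T a, θ, hθ, tendsto_iff_norm_sub_tendsto_zero.2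
      (squeeze_zero (fun _ => norm_nonneg _) (fun n => ?_) hlim)⟩
    rw [← hxw, ← map_sub, ← (hT _).tsum_eq]
    refine tsum_of_norm_bounded (summable_abs_apply hφ0 hψ _).hasSum fun k => ?_
    rw [norm_smul]
    exact mul_le_of_le_one_right (norm_nonneg _) (hy1 k)
  · have hnorm : ∀ n, δ / 2 < ‖φ n‖ := fun n => (half_lt_self hδ).trans_le (hφδ n)
    choose x hx0 hx1 hx using fun n => exists_nonneg_lt_abs_apply (hnorm n)
    obtain ⟨n, hn⟩ := (Metric.tendstoUniformlyOn_iff.1 (hAL.2 g hgd hg) (δ / 2 * ε)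
      (by positivity)).exists
    have h1 := hn (T (x n)) ⟨x n, by simpa using hx1 n, rfl⟩
    rw [dist_comm, Real.dist_eq, sub_zero] at h1
    have h2 : φ n (x n) • y n ≤ T (x n) := le_hasSum (hT (x n)) n fun k _ => hterm _ (hx0 n) k
    have h3 := apply_mono (hg0 n) h2
    rw [map_smul, smul_eq_mul] at h3
    have h4 : δ / 2 * ε ≤ φ n (x n) * g n (y n) := by
      have h5 := hx n
      rw [abs_of_nonneg (hφ0 n)] at h5
      exact mul_le_mul h5.le (hgy n) hε.le (hφ0 n _ (hx0 n))
    linarith [le_abs_self (g n (T (x n)))]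

end AlmostLimited

end BanachLattice

/-! ### The characterization -/

theorem mainTheorem1 {E : Type*} {F : Type*}
    [NormedAddCommGroup E] [NormedSpace ℝ E] [CompleteSpace E]
    [Lattice E] [IsOrderedAddMonoid E] [IsOrderedModule ℝ E] [HasSolidNorm E]
    [NormedAddCommGroup F] [NormedSpace ℝ F] [CompleteSpace F]
    [Lattice F] [IsOrderedAddMonoid F] [IsOrderedModule ℝ F] [HasSolidNorm F]
    (hF : BanachLattice.HasPropertyD F) :
    List.TFAE [
      ∀ T : E →L[ℝ] F, BanachLattice.IsOrderBounded T →
        BanachLattice.IsWeakAlmostLimitedOp T → BanachLattice.IsAlmostLimitedOp T,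
      ∀ T : E →L[ℝ] F, BanachLattice.IsPositiveOp T →
        BanachLattice.IsWeakAlmostLimitedOp T → BanachLattice.IsAlmostLimitedOp T,
      BanachLattice.HasPositiveDualSchur F ∨
        BanachLattice.HasOrderContinuousNorm (StrongDual ℝ E)] := by
  tfae_have 1 → 2 := fun h T hT => h T hT.isOrderBounded
  tfae_have 2 → 3 := fun h => by
    by_contra! hcon
    obtain ⟨T, hT, hW, hAL⟩ :=
      BanachLattice.exists_positive_weakAlmostLimited_not_almostLimited hcon.1 hcon.2
    exact hAL (h T hT hW)
  tfae_have 3 → 1 := by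
    rintro (hS | hE) T hT hW
    · exact hS.isAlmostLimitedOp hF T
    · exact hW.isAlmostLimitedOp hT hF hE
  tfae_finish
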